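/- Let $H$ be a complex separable Hilbert space, $\mathcal B(H)$ the algebra of bounded linear operators on $H$, and $\mathcal K(H)$ the ideal of compact operators. Put $$\mathfrak c(\mathrm{nil}_2)=\{MN-NM : M,N\in\mathcal B(H),\ M^2=0=N^2\},$$ and let $\operatorname{clos}(\mathfrak c(\mathrm{nil}_2))$ be its closure in the operator norm. Let $\sigma(T)$ be the spectrum of $T$ and let the essential spectrum $\sigma_e(T)$ be the spectrum of the image of $T$ in the Calkin algebra $\mathcal B(H)/\mathcal K(H)$. For an isolated point $\alpha$ of $\sigma(T)$ let $H(\{\alpha\};T)$ be the range of the Riesz idempotent $$E(\{\alpha\};T)=\frac1{2\pi i}\oint_{|z-\alpha|=r}(z-T)^{-1}\,dz,$$ where $r>0$ is any radius such that $\alpha$ is the only point of $\sigma(T)$ in the disc $|z-\alpha|\le r$. Let $T\in\mathcal B(H)$. 1. If $T\in\mathfrak c(\mathrm{nil}_2)$, then (a) every connected component of $\sigma(T)$ intersects $\sigma(-T)$, and (b) every connected component of $\sigma_e(T)$ intersects $\sigma_e(-T)$. 2. If $T\in\operatorname{clos}(\mathfrak c(\mathrm{nil}_2))$, then (a) every connected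 component of $\sigma(T)$ intersects $\sigma(-T)$, and (b) every connected component of $\sigma_e(T)$ intersects $\sigma_e(-T)$. 3. If $T\in\operatorname{clos}(\mathfrak c(\mathrm{nil}_2))$ and both $\alpha$ and $-\alpha$ are isolated points of $\sigma(T)$, then $$\dim H(\{\alpha\};T)=\dim H(\{-\alpha\};T),$$ where dimensions are taken in $\{0,1,2,\dots\}\cup\{\infty\}$. -/

import Mathlib

open scoped Topology Real

noncomputable section

namespace SquareZeroCommutator

section Ring

variable {R : Type*} [Ring R]

/-- The set of square-zero elements of a ring. -/
def nilTwo (R : Type*) [Ring R] : Set R :=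
  {M | M ^ 2 = 0}

/-- The set of all commutators `A * B - B * A` with `A` and `B` in the set `S`. -/
def commutators (S : Set R) : Set R :=
  {T | ∃ A ∈ S, ∃ B ∈ S, T = A * B - B * A}

end Ring

/-- Every connected component of `S` meets `S'`. -/
def EveryComponentMeets (S S' : Set ℂ) : Prop :=
  ∀ z ∈ S, (connectedComponentIn S z ∩ S').Nonempty

/-- `z` is an isolated point of `S`: it lies in `S` and is not an accumulation point of `S`. -/
def IsIsolatedPoint (S : Set ℂ) (z : ℂ) : Prop :=
  z ∈ S ∧ ¬ AccPt z (Filter.principal S)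

section Operators

variable {H : Type*} [NormedAddCommGroup H] [InnerProductSpace ℂ H]

/-- The ideal `K(H)` of compact operators in `B(H)`. -/
def compactIdeal (H : Type*) [NormedAddCommGroup H] [InnerProductSpace ℂ H] :
    Ideal (H →L[ℂ] H) where
  carrier := {K | IsCompactOperator K}
  add_mem' := fun ha hb => IsCompactOperator.add ha hb
  zero_mem' := isCompactOperator_zero
  smul_mem' := fun A _ hK => IsCompactOperator.clm_comp hK A

/-- The ideal of compact operators is two-sided. -/
instance compactIdeal_isTwoSided : (compactIdeal H).IsTwoSided where
  mul_mem_of_left := fun A hK => IsCompactOperator.comp_clm hK A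

/-- The Calkin algebra `B(H) / K(H)`. -/
abbrev Calkin (H : Type*) [NormedAddCommGroup H] [InnerProductSpace ℂ H] : Type _ :=
  (H →L[ℂ] H) ⧸ compactIdeal H

/-- The essential spectrum of `T`: the spectrum of its image in the Calkin algebra. -/
def essentialSpectrum (T : H →L[ℂ] H) : Set ℂ :=
  spectrum ℂ (Ideal.Quotient.mk (compactIdeal H) T : Calkin H)

/-- The Cauchy integral `(2πi)⁻¹ ∮ (z - T)⁻¹ dz` over the positively oriented circle `|z - α| = r`.
-/
def cauchyResolvent (T : H →L[ℂ] H) (α : ℂ) (r : ℝ) : H →L[ℂ] H :=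
  (2 * π * Complex.I : ℂ)⁻¹ • ∮ z in C(α, r), resolvent T z

/-- The closed disc of radius `r > 0` about `α` contains no point of the spectrum of `T` except
possibly `α`. -/
def IsolatingRadius (T : H →L[ℂ] H) (α : ℂ) (r : ℝ) : Prop :=
  0 < r ∧ Metric.closedBall α r ∩ spectrum ℂ T ⊆ {α}

/-- An isolated point of the spectrum has an isolating radius. -/
theorem exists_isolatingRadius {T : H →L[ℂ] H} {α : ℂ}
    (h : IsIsolatedPoint (spectrum ℂ T) α) : ∃ r, IsolatingRadius T α r := by
  have h2 := h.2
  rw [accPt_iff_frequently, Filter.not_frequently] at h2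
  obtain ⟨r, hr, hb⟩ := Metric.nhds_basis_closedBall.eventually_iff.1 h2
  refine ⟨r, hr, fun z hz => ?_⟩
  by_contra hne
  exact hb hz.1 ⟨hne, hz.2⟩

/-- The Cauchy integral of the resolvent is the same for all isolating radii. -/
theorem cauchyResolvent_eq [CompleteSpace H] {T : H →L[ℂ] H} {α : ℂ} {r s : ℝ}
    (hr : IsolatingRadius T α r) (hs : IsolatingRadius T α s) :
    cauchyResolvent T α r = cauchyResolvent T α s := by
  wlog hle : s ≤ r generalizing r s
  · exact (this hs hr (le_of_not_ge hle)).symm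
  have hd : ∀ z ∈ Metric.closedBall α r \ Metric.ball α s,
      DifferentiableAt ℂ (resolvent T) z := by
    intro z hz
    have hz' : z ∈ resolventSet ℂ T := by
      by_contra hmem
      have hzα : z = α := hr.2 ⟨hz.1, hmem⟩
      exact hz.2 (hzα ▸ Metric.mem_ball_self hs.1)
    exact (spectrum.hasDerivAt_resolvent_const_left hz').differentiableAt
  unfold cauchyResolvent
  congr 1
  refine Complex.circleIntegral_eq_of_differentiable_on_annulus_off_countable hs.1 hle
    Set.countable_empty (fun z hz => (hd z hz).continuousAt.continuousWithinAt) fun z hz => ?_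
  exact hd z ⟨Metric.ball_subset_closedBall hz.1.1,
    fun h => hz.1.2 (Metric.ball_subset_closedBall h)⟩

open Classical in
/-- The Riesz idempotent `E({α}; T)` of an isolated point `α` of the spectrum of `T`, computed over
any circle about `α` that separates `α` from the rest of the spectrum (and `0` if there is no such
circle). -/
def rieszIdempotent (T : H →L[ℂ] H) (α : ℂ) : H →L[ℂ] H :=
  if h : ∃ r, IsolatingRadius T α r then cauchyResolvent T α h.choose else 0

/-- The Riesz idempotent may be computed over any isolating circle. -/
theorem rieszIdempotent_eq [CompleteSpace H] {T : H →L[ℂ] H} {α : ℂ} {r : ℝ}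
    (hr : IsolatingRadius T α r) : rieszIdempotent T α = cauchyResolvent T α r := by
  have h : ∃ r, IsolatingRadius T α r := ⟨r, hr⟩
  rw [rieszIdempotent, dif_pos h]
  exact cauchyResolvent_eq h.choose_spec hr

/-- The Riesz subspace `H({α}; T)`: the range of the Riesz idempotent `E({α}; T)`. -/
def rieszSpace (T : H →L[ℂ] H) (α : ℂ) : Submodule ℂ H :=
  LinearMap.range (rieszIdempotent T α : H →ₗ[ℂ] H)

/-- The dimension of a subspace as an element of `{0, 1, 2, …, ∞}`. For a closed subspace of a
separable Hilbert space this is the number of vectors in an orthonormal basis. -/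
def dimension (V : Submodule ℂ H) : ℕ∞ :=
  Cardinal.toENat (Module.rank ℂ V)

end Operators

end SquareZeroCommutator

end

open scoped Topology Real

noncomputable section

namespace SquareZeroCommutator


/-! ### Algebraic core: the anticommuting fourth root and the symmetry of the spectrum. -/

section Ring

variable {R : Type*} [Ring R]

/-! For `T = M * N - N * M` with `M`, `N` square-zero, the element `X = M + N` satisfies `X * T =
-(T * X)` and `X ^ 4 = T ^ 2`, both sides of the latter being `MNMN + NMNM`. Everything rests on
these two identities, which make sense in any ring.

They force the spectrum of a genuine commutator to be symmetric under `z ↦ -z`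
(`neg_mem_spectrum_of_anticommuting`). For a limit `T`, suppose a component of the spectrum misses
the spectrum of `-T`. It lies in a clopen piece that also misses it, and by Newburgh's theorem
(`eventually_spectrum_inter_nonempty`) nearby commutators keep spectrum near that piece but have
none near its negative, contradicting symmetry. The argument works in every complex Banach algebra,
so applying it to the Calkin algebra yields the essential spectrum.

For the dimensions, `X` carries the Riesz range at `α` into the one at `-α`, injectively when `α ≠
0` because `X ^ 4 = T ^ 2` is invertible there. The ranks of Cauchy integrals over fixed circles are
locally constant in the operator, so equality passes to limits. -/

theorem exists_anticommuting_of_mem_commutators {T : R}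
    (hT : T ∈ commutators (nilTwo R)) : ∃ X : R, X * T = -(T * X) ∧ X ^ 4 = T ^ 2 := by
  obtain ⟨M, hM, N, hN, rfl⟩ := hT
  have hM' : M * M = 0 := by rw [← pow_two]; exact hM
  have hN' : N * N = 0 := by rw [← pow_two]; exact hN
  have hM2 : ∀ x, M * (M * x) = 0 := fun x => by rw [← mul_assoc, hM', zero_mul]
  have hN2 : ∀ x, N * (N * x) = 0 := fun x => by rw [← mul_assoc, hN', zero_mul]
  refine ⟨M + N, ?_, ?_⟩
  · simp only [mul_add, add_mul, mul_sub, sub_mul, mul_assoc, hM', hN', hM2, hN2, mul_zero]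
    abel
  · simp only [pow_succ, pow_zero, one_mul, mul_add, add_mul, mul_sub, sub_mul, mul_assoc, hM',
      hN', hM2, hN2, mul_zero, zero_mul]
    abel

theorem isUnit_of_mul_eq_one {a b c : R} (h₁ : b * a = 1) (h₂ : a * c = 1) : IsUnit a :=
  ⟨⟨a, b, by rwa [left_inv_eq_right_inv h₁ h₂], h₁⟩, rfl⟩

end Ring

section Algebra

variable {A : Type*} [Ring A] [Algebra ℂ A]

/-- Let `a = z - T` and suppose `u = -z - T` is a unit. Anticommutation turns `X * a` into `-(u *
X)`, so `X`, and hence `T ^ 2 = X ^ 4`, is a left and a right multiple of `a`. So is `z ^ 2 = T ^ 2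
- u * a`, a nonzero scalar, which makes `a` invertible. -/
theorem neg_mem_spectrum_of_anticommuting {T X : A} (hX : X * T = -(T * X))
    (hXT : X ^ 4 = T ^ 2) {z : ℂ} (hz : z ∈ spectrum ℂ T) : -z ∈ spectrum ℂ T := by
  rcases eq_or_ne z 0 with rfl | hz0
  · simpa using hz
  by_contra hneg
  apply hz
  have hu : IsUnit (algebraMap ℂ A (-z) - T) := not_not.1 hneg
  obtain ⟨u, hu⟩ := hu
  set a := algebraMap ℂ A z - T with ha
  have hc : ∀ x : A, x * algebraMap ℂ A z = algebraMap ℂ A z * x :=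
    fun x => (Algebra.commutes z x).symm
  have h1 : X * a = -(u * X) := by
    rw [hu, ha, map_neg, mul_sub, hX, hc, sub_mul, neg_mul]; abel
  have h2 : a * X = -(X * u) := by
    rw [hu, ha, map_neg, mul_sub, hX, mul_neg, hc, sub_mul]; abel
  have h3 : X = -(↑u⁻¹ * X * a) := by
    rw [mul_assoc, h1, mul_neg, neg_neg, Units.inv_mul_cancel_left]
  have h4 : X = -(a * X * ↑u⁻¹) := by
    rw [h2, neg_mul, neg_neg, Units.mul_inv_cancel_right]
  have h5 : algebraMap ℂ A (z ^ 2) = T ^ 2 - u * a := by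
    rw [hu, ha, map_neg, mul_sub, sub_mul, sub_mul, neg_mul, hc T, map_pow, pow_two, pow_two,
      neg_mul]; abel
  have h6 : algebraMap ℂ A (z ^ 2) = T ^ 2 - a * u := by
    rw [hu, ha, map_neg, mul_sub, sub_mul, sub_mul, mul_neg, mul_neg, hc T, map_pow, pow_two, pow_two]
    abel
  have hz2 : z ^ 2 ≠ 0 := pow_ne_zero 2 hz0
  have h7 : T ^ 2 = -(X ^ 3 * ↑u⁻¹ * X) * a := by
    rw [← hXT, pow_succ X 3]
    nth_rw 2 [h3]
    noncomm_ring
  have h8 : T ^ 2 = a * -(X * ↑u⁻¹ * X ^ 3) := by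
    rw [← hXT, pow_succ' X 3]
    nth_rw 1 [h4]
    noncomm_ring
  have hinv : algebraMap ℂ A (z ^ 2)⁻¹ * algebraMap ℂ A (z ^ 2) = 1 := by
    rw [← map_mul, inv_mul_cancel₀ hz2, map_one]
  refine isUnit_of_mul_eq_one (b := algebraMap ℂ A (z ^ 2)⁻¹ * (-(X ^ 3 * ↑u⁻¹ * X) - u))
    (c := (-(X * ↑u⁻¹ * X ^ 3) - u) * algebraMap ℂ A (z ^ 2)⁻¹) ?_ ?_
  · rw [mul_assoc, sub_mul, ← h7, ← h5, hinv]
  · rw [← mul_assoc, mul_sub, ← h8, ← h6, Algebra.commutes, hinv]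

theorem neg_mem_spectrum_of_mem_commutators {T : A} (hT : T ∈ commutators (nilTwo A)) {z : ℂ}
    (hz : z ∈ spectrum ℂ T) : -z ∈ spectrum ℂ T := by
  obtain ⟨X, hX, hXT⟩ := exists_anticommuting_of_mem_commutators hT
  exact neg_mem_spectrum_of_anticommuting hX hXT hz

end Algebra

/-! ### Perturbation of spectrum and resolvent in Banach algebras. -/

section BanachAlgebra

theorem isUnit_of_norm_inverse_mul_lt {A : Type*} [NormedRing A] [CompleteSpace A] {x y : A} (hy : IsUnit y)
    (h : ‖Ring.inverse y‖ * ‖y - x‖ < 1) : IsUnit x := by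
  have h1 : IsUnit (1 - Ring.inverse y * (y - x)) :=
    isUnit_one_sub_of_norm_lt_one ((norm_mul_le _ _).trans_lt h)
  have h2 : x = y * (1 - Ring.inverse y * (y - x)) := by
    rw [mul_sub, ← mul_assoc, Ring.mul_inverse_cancel y hy]; simp
  rw [h2]
  exact hy.mul h1

variable {A : Type*} [NormedRing A] [NormedAlgebra ℂ A] [CompleteSpace A]

theorem continuousAt_resolvent_prod {a : A} {z : ℂ} (hz : z ∈ resolventSet ℂ a) :
    ContinuousAt (fun p : A × ℂ => resolvent p.1 p.2) (a, z) := by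
  obtain ⟨u, hu⟩ := hz
  have h : ContinuousAt (fun p : A × ℂ => algebraMap ℂ A p.2 - p.1) (a, z) :=
    ((continuous_algebraMap ℂ A).comp continuous_snd |>.sub continuous_fst).continuousAt
  have h' : ContinuousAt Ring.inverse (algebraMap ℂ A z - a) := by
    rw [← hu]; exact NormedRing.inverse_continuousAt u
  exact ContinuousAt.comp (f := fun p : A × ℂ => algebraMap ℂ A p.2 - p.1) h' h

theorem eventually_subset_resolventSet {a : A} {K : Set ℂ} (hK : IsCompact K)
    (h : K ⊆ resolventSet ℂ a) : ∀ᶠ b in 𝓝 a, K ⊆ resolventSet ℂ b := by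
  refine hK.eventually_forall_of_forall_eventually
    (P := fun (b : A) (z : ℂ) => z ∈ resolventSet ℂ b) fun z hz => ?_
  have hc : Continuous fun p : A × ℂ => algebraMap ℂ A p.2 - p.1 :=
    (continuous_algebraMap ℂ A).comp continuous_snd |>.sub continuous_fst
  exact (Units.isOpen.preimage hc).mem_nhds (h hz : IsUnit _)

theorem eventually_norm_resolvent_sub_lt {a : A} {K : Set ℂ} (hK : IsCompact K)
    (h : K ⊆ resolventSet ℂ a) {ε : ℝ} (hε : 0 < ε) :
    ∀ᶠ b in 𝓝 a, ∀ z ∈ K, ‖resolvent b z - resolvent a z‖ < ε := by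
  refine hK.eventually_forall_of_forall_eventually
    (P := fun (b : A) (z : ℂ) => ‖resolvent b z - resolvent a z‖ < ε) fun z hz => ?_
  have h1 := continuousAt_resolvent_prod (h hz)
  have h2 : ContinuousAt (fun p : A × ℂ => resolvent a p.2) (a, z) :=
    ContinuousAt.comp (f := fun p : A × ℂ => (a, p.2)) (x := (a, z)) h1 (by fun_prop)
  have h3 := (h1.sub h2).norm
  exact h3.eventually (gt_mem_nhds (by simpa using hε))

theorem continuousOn_resolvent {a : A} {S : Set ℂ} (h : S ⊆ resolventSet ℂ a) :
    ContinuousOn (resolvent a) S := fun _ hz =>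
  (spectrum.hasDerivAt_resolvent_const_left (h hz)).continuousAt.continuousWithinAt

/-- **Newburgh's theorem**: an open set that meets the spectrum of `a`, and whose frontier does
not, meets the spectra of all elements near `a`. -/
theorem eventually_spectrum_inter_nonempty {a : A} {U : Set ℂ} (hU : Bornology.IsBounded U)
    (hfr : frontier U ⊆ resolventSet ℂ a) (hne : (spectrum ℂ a ∩ U).Nonempty) :
    ∀ᶠ b in 𝓝 a, (spectrum ℂ b ∩ U).Nonempty := by
  obtain ⟨z, hza, hzU⟩ := hne
  have hK : IsCompact (frontier U) :=
    Metric.isCompact_of_isClosed_isBounded isClosed_frontier (hU.closure.subset frontier_subset_closure)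
  obtain ⟨C, hC⟩ := hK.exists_bound_of_continuousOn (continuousOn_resolvent hfr)
  have hC' : 0 < |C| + 1 := by positivity
  filter_upwards [eventually_subset_resolventSet hK hfr,
    eventually_norm_resolvent_sub_lt hK hfr one_pos,
    Metric.ball_mem_nhds a (inv_pos.2 hC')] with b hb1 hb2 hb3
  by_contra hempty
  have hUb : closure U ⊆ resolventSet ℂ b := by
    rw [closure_eq_self_union_frontier]
    refine Set.union_subset (fun w hw => ?_) hb1
    by_contra hw'
    exact hempty ⟨w, hw', hw⟩
  have hd : DiffContOnCl ℂ (resolvent b) U := by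
    refine ⟨fun w hw => ?_, continuousOn_resolvent hUb⟩
    exact (spectrum.hasDerivAt_resolvent_const_left
      (hUb (subset_closure hw))).differentiableAt.differentiableWithinAt
  -- If the spectrum of `b` missed `U`, the maximum principle would carry the frontier bound inside;
  -- `z - a` is then too close to the unit `z - b` to be singular.
  have hle : ‖resolvent b z‖ ≤ |C| + 1 := by
    refine Complex.norm_le_of_forall_mem_frontier_norm_le hU hd (fun w hw => ?_)
      (subset_closure hzU)
    calc ‖resolvent b w‖ = ‖resolvent a w + (resolvent b w - resolvent a w)‖ := by simp
      _ ≤ ‖resolvent a w‖ + ‖resolvent b w - resolvent a w‖ := norm_add_le _ _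
      _ ≤ |C| + 1 := add_le_add ((hC w hw).trans (le_abs_self C)) (hb2 w hw).le
  refine hza (isUnit_of_norm_inverse_mul_lt (hUb (subset_closure hzU)) ?_)
  have hba : ‖algebraMap ℂ A z - b - (algebraMap ℂ A z - a)‖ < (|C| + 1)⁻¹ := by
    rw [sub_sub_sub_cancel_left, ← dist_eq_norm, dist_comm]; exact hb3
  calc _ ≤ (|C| + 1) * ‖algebraMap ℂ A z - b - (algebraMap ℂ A z - a)‖ :=
        mul_le_mul_of_nonneg_right hle (norm_nonneg _)
    _ < (|C| + 1) * (|C| + 1)⁻¹ := mul_lt_mul_of_pos_left hba hC'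
    _ = 1 := mul_inv_cancel₀ hC'.ne'

end BanachAlgebra

/-! ### Components of the spectrum under limits. -/

/-- If a component of a compact set misses a closed set, it lies in a relatively clopen subset that
does so too. -/
theorem exists_clopen_piece {S F : Set ℂ} (hS : IsCompact S) (hF : IsClosed F) {z : ℂ}
    (hz : z ∈ S) (h : ¬ (connectedComponentIn S z ∩ F).Nonempty) :
    ∃ D ⊆ S, z ∈ D ∧ IsCompact D ∧ IsCompact (S \ D) ∧ Disjoint D F := by
  have : CompactSpace S := isCompact_iff_compactSpace.1 hS
  have hcc := connectedComponent_eq_iInter_isClopen (⟨z, hz⟩ : S)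
  have hF' : IsCompact ((↑) ⁻¹' F : Set S) := (hF.preimage continuous_subtype_val).isCompact
  have : Nonempty { s : Set S // IsClopen s ∧ (⟨z, hz⟩ : S) ∈ s } :=
    ⟨⟨Set.univ, isClopen_univ, trivial⟩⟩
  have hdir : Directed (· ⊇ ·) fun s : { s : Set S // IsClopen s ∧ (⟨z, hz⟩ : S) ∈ s } =>
      (s : Set S) := fun s t =>
    ⟨⟨s.1 ∩ t.1, s.2.1.inter t.2.1, s.2.2, t.2.2⟩, Set.inter_subset_left, Set.inter_subset_right⟩
  -- In a compact Hausdorff space the component is the intersection of the clopen sets around the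
  -- point; by compactness one of them already misses `F`.
  obtain ⟨s, hs⟩ := hF'.elim_directed_family_closed
    (fun s : { s : Set S // IsClopen s ∧ (⟨z, hz⟩ : S) ∈ s } => (s : Set S))
    (fun s => s.2.1.isClosed) (by
      rw [← hcc, ← Set.not_nonempty_iff_eq_empty]
      rintro ⟨w, hw1, hw2⟩
      refine h ⟨w, ?_, hw1⟩
      rw [connectedComponentIn_eq_image hz]
      exact ⟨w, hw2, rfl⟩) hdir
  refine ⟨(↑) '' s.1, by rintro _ ⟨w, -, rfl⟩; exact w.2, ⟨_, s.2.2, rfl⟩,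
    s.2.1.isClosed.isCompact.image continuous_subtype_val, ?_, ?_⟩
  · have : S \ ((↑) '' s.1) = (↑) '' (s.1ᶜ) := by
      ext w
      constructor
      · rintro ⟨hw, hn⟩
        exact ⟨⟨w, hw⟩, fun hm => hn ⟨_, hm, rfl⟩, rfl⟩
      · rintro ⟨w, hw, rfl⟩
        refine ⟨w.2, ?_⟩
        rintro ⟨v, hv, hvw⟩
        exact hw (Subtype.ext hvw ▸ hv)
    rw [this]
    exact s.2.1.compl.isClosed.isCompact.image continuous_subtype_val
  · rw [Set.disjoint_left]
    rintro _ ⟨w, hw, rfl⟩ hwF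
    exact (Set.eq_empty_iff_forall_notMem.1 hs w) ⟨hwF, hw⟩

theorem everyComponentMeets_of_mem_closure {A : Type*} [NormedRing A] [NormedAlgebra ℂ A]
    [CompleteSpace A] {T : A} (hT : T ∈ closure (commutators (nilTwo A))) :
    EveryComponentMeets (spectrum ℂ T) (spectrum ℂ (-T)) := by
  intro z hz
  by_contra h
  have hcomp : ∀ a : A, IsCompact (spectrum ℂ a) := fun a => spectrum.isCompact a
  obtain ⟨D, hDS, hzD, hD, hSD, hdisj⟩ := exists_clopen_piece (hcomp T) (hcomp (-T)).isClosed hz h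
  have hFc : IsClosed (spectrum ℂ T \ D ∪ spectrum ℂ (-T)) :=
    hSD.isClosed.union (hcomp (-T)).isClosed
  have hdF : Disjoint D (spectrum ℂ T \ D ∪ spectrum ℂ (-T)) :=
    Set.disjoint_union_right.2 ⟨Set.disjoint_sdiff_right, hdisj⟩
  obtain ⟨δ, hδ, hδF⟩ := hdF.exists_cthickenings hD hFc
  set U := Metric.thickening δ D with hUdef
  have hUo : IsOpen U := Metric.isOpen_thickening
  have hDU : D ⊆ U := Metric.self_subset_thickening hδ D
  have hcl : closure U ⊆ Metric.cthickening δ D := Metric.closure_thickening_subset_cthickening δ D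
  have hclF : ∀ w ∈ closure U, w ∉ spectrum ℂ T \ D ∪ spectrum ℂ (-T) := fun w hw hwF =>
    Set.disjoint_left.1 hδF (hcl hw) (Metric.self_subset_cthickening _ hwF)
  have hUb : Bornology.IsBounded U := hD.isBounded.thickening
  have hfr : frontier U ⊆ resolventSet ℂ T := by
    intro w hw
    by_contra hwT
    have hwD : w ∉ D := fun hwD => (hUo.frontier_eq ▸ hw).2 (hDU hwD)
    exact hclF w (frontier_subset_closure hw) (Or.inl ⟨hwT, hwD⟩)
  have hnegK : IsCompact (-closure U) :=
    (Metric.isCompact_of_isClosed_isBounded isClosed_closure hUb.closure).neg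
  have hneg : -closure U ⊆ resolventSet ℂ T := by
    intro w hw
    by_contra hwT
    refine hclF (-w) hw (Or.inr ?_)
    rw [← spectrum.neg_eq]
    exact Set.neg_mem_neg.2 hwT
  -- A commutator `S` near `T` has a spectral point in `U`, yet none in `-closure U`.
  obtain ⟨S, hS, hS1, hS2⟩ := ((mem_closure_iff_frequently.1 hT).and_eventually
    ((eventually_spectrum_inter_nonempty hUb hfr ⟨z, hz, hDU hzD⟩).and
      (eventually_subset_resolventSet hnegK hneg))).exists
  obtain ⟨w, hw, hwU⟩ := hS1
  refine neg_mem_spectrum_of_mem_commutators hS hw (hS2 ?_)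
  simpa using subset_closure hwU


/-! ### The Calkin algebra as a Banach algebra. -/

section Calkin

variable {H : Type*} [NormedAddCommGroup H] [InnerProductSpace ℂ H]

theorem isClosed_compactIdeal [CompleteSpace H] :
    IsClosed ((compactIdeal H : Ideal (H →L[ℂ] H)) : Set (H →L[ℂ] H)) :=
  isClosed_setOfPred_isCompactOperator

/-- The Calkin algebra is a normed ring under the quotient norm. -/
@[reducible]
def calkinNormedRing [CompleteSpace H] : NormedRing (Calkin H) :=
  haveI : IsClosed ((compactIdeal H : Submodule (H →L[ℂ] H) (H →L[ℂ] H)) : Set (H →L[ℂ] H)) :=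
    isClosed_compactIdeal
  { Submodule.Quotient.normedAddCommGroup (compactIdeal H), Ideal.Quotient.ring (compactIdeal H) with
    norm_mul_le := fun x y => by
      -- The quotient norm is an infimum over lifts, so nearly optimal lifts give
      -- submultiplicativity up to `ε`.
      refine le_of_forall_pos_le_add fun ε hε => ?_
      have hlim : Filter.Tendsto (fun δ : ℝ => (‖x‖ + δ) * (‖y‖ + δ)) (𝓝[>] 0)
          (𝓝 (‖x‖ * ‖y‖)) := by
        have : ContinuousAt (fun δ : ℝ => (‖x‖ + δ) * (‖y‖ + δ)) 0 := by fun_prop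
        simpa [ContinuousAt] using this.tendsto.mono_left nhdsWithin_le_nhds
      obtain ⟨δ, h1, hδ⟩ := ((hlim.eventually (gt_mem_nhds (lt_add_of_pos_right _ hε))).and
        self_mem_nhdsWithin).exists
      obtain ⟨a, rfl, ha⟩ := Submodule.Quotient.norm_mk_lt x hδ
      obtain ⟨b, rfl, hb⟩ := Submodule.Quotient.norm_mk_lt y hδ
      calc _ ≤ ‖a * b‖ := Submodule.Quotient.norm_mk_le (compactIdeal H) (a * b)
        _ ≤ ‖a‖ * ‖b‖ := norm_mul_le a b
        _ ≤ _ := mul_le_mul ha.le hb.le (norm_nonneg _) ((norm_nonneg _).trans ha.le)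
        _ ≤ _ := h1.le }

theorem everyComponentMeets_essentialSpectrum_of_mem_closure [CompleteSpace H] {T : H →L[ℂ] H}
    (hT : T ∈ closure (commutators (nilTwo (H →L[ℂ] H)))) :
    EveryComponentMeets (essentialSpectrum T) (essentialSpectrum (-T)) := by
  -- The norm is added to the existing quotient ring and algebra structures, so the spectrum is
  -- still the one in `essentialSpectrum`.
  let _ : NormedRing (Calkin H) := calkinNormedRing
  let _ : NormedAlgebra ℂ (Calkin H) :=
    { Ideal.Quotient.algebra ℂ with
      norm_smul_le := fun c x => norm_smul_le (α := ℂ) (β := (H →L[ℂ] H) ⧸ compactIdeal H) c x }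
  have : CompleteSpace (Calkin H) := Submodule.Quotient.completeSpace (compactIdeal H)
  have hcont : Continuous (Ideal.Quotient.mk (compactIdeal H)) :=
    AddMonoidHomClass.continuous_of_bound _ 1 fun a => by
      rw [one_mul]; exact Submodule.Quotient.norm_mk_le (compactIdeal H) a
  have hmem : (Ideal.Quotient.mk (compactIdeal H) T : Calkin H) ∈
      closure (commutators (nilTwo (Calkin H))) := by
    refine map_mem_closure hcont hT ?_
    rintro _ ⟨M, hM, N, hN, rfl⟩
    have key : ∀ L : H →L[ℂ] H, L ∈ nilTwo (H →L[ℂ] H) →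
        (Ideal.Quotient.mk (compactIdeal H) L : Calkin H) ∈ nilTwo (Calkin H) := by
      intro L (hL : L ^ 2 = 0)
      change _ ^ 2 = _
      rw [← map_pow, hL, map_zero]
    exact ⟨_, key M hM, _, key N hN, by simp only [map_sub, map_mul]⟩
  have := everyComponentMeets_of_mem_closure hmem
  rwa [← map_neg] at this

end Calkin


/-! ### Circle integrals: bounded operators, Fubini, reflection. -/

section CircleIntegral

variable {E F : Type*} [NormedAddCommGroup E] [NormedSpace ℂ E] [NormedAddCommGroup F]
  [NormedSpace ℂ F]

theorem clm_apply_circleIntegral [CompleteSpace E] [CompleteSpace F] (L : E →L[ℂ] F) {f : ℂ → E}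
    {c : ℂ} {R : ℝ} (hf : CircleIntegrable f c R) :
    L (∮ z in C(c, R), f z) = ∮ z in C(c, R), L (f z) := by
  rw [circleIntegral, circleIntegral, ← L.intervalIntegral_comp_comm hf.out]
  simp only [map_smul]

theorem circleIntegral_swap {f : ℂ → ℂ → E} {c c' : ℂ} {R R' : ℝ} (hR : 0 ≤ R) (hR' : 0 ≤ R')
    (hf : ContinuousOn (Function.uncurry f) (Metric.sphere c R ×ˢ Metric.sphere c' R')) :
    (∮ z in C(c, R), ∮ w in C(c', R'), f z w) = ∮ w in C(c', R'), ∮ z in C(c, R), f z w := by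
  have hcont : Continuous (Function.uncurry fun θ φ : ℝ =>
      deriv (circleMap c R) θ • deriv (circleMap c' R') φ •
        f (circleMap c R θ) (circleMap c' R' φ)) := by
    have h : Continuous fun p : ℝ × ℝ => f (circleMap c R p.1) (circleMap c' R' p.2) :=
      hf.comp_continuous (f := fun p : ℝ × ℝ => (circleMap c R p.1, circleMap c' R' p.2))
        (by fun_prop) fun p => ⟨circleMap_mem_sphere c hR _, circleMap_mem_sphere c' hR' _⟩
    have h1 : ∀ c R, Continuous (deriv (circleMap c R)) := fun c R => by
      rw [funext (deriv_circleMap c R)]; fun_prop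
    exact ((h1 c R).comp continuous_fst).smul (((h1 c' R').comp continuous_snd).smul h)
  have hint : MeasureTheory.IntegrableOn (Function.uncurry fun θ φ : ℝ =>
      deriv (circleMap c R) θ • deriv (circleMap c' R') φ •
        f (circleMap c R θ) (circleMap c' R' φ))
      (Set.uIoc 0 (2 * π) ×ˢ Set.uIoc 0 (2 * π)) :=
    (hcont.continuousOn.integrableOn_compact (isCompact_uIcc.prod isCompact_uIcc)).mono_set
      (Set.prod_mono Set.uIoc_subset_uIcc Set.uIoc_subset_uIcc)
  simp only [circleIntegral, ← intervalIntegral.integral_smul]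
  rw [MeasureTheory.intervalIntegral_intervalIntegral_swap hint]
  simp only [smul_comm (deriv (circleMap c' R') _) (deriv (circleMap c R) _)]

/-- Negation shifts the angle by `π`, which periodicity absorbs; the sign comes from `dz`. -/
theorem circleIntegral_comp_neg (f : ℂ → E) (c : ℂ) (R : ℝ) :
    (∮ z in C(c, R), f (-z)) = -∮ z in C(-c, R), f z := by
  have h : ∀ θ, circleMap (-c) R (θ + π) = -circleMap c R θ := fun θ => by
    simp [circleMap, add_mul, Complex.exp_add]; ring
  have h0 : ∀ θ, circleMap 0 R (θ + π) = -circleMap 0 R θ := fun θ => by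
    simp [circleMap, add_mul, Complex.exp_add]
  have hper : Function.Periodic
      (fun θ => deriv (circleMap (-c) R) θ • f (circleMap (-c) R θ)) (2 * π) := fun θ => by
    simp only [deriv_circleMap, periodic_circleMap _ _ θ]
  have := hper.intervalIntegral_add_eq 0 π
  rw [zero_add] at this
  rw [circleIntegral, circleIntegral, this, add_comm π,
    ← zero_add π, ← add_assoc, ← intervalIntegral.integral_comp_add_right,
    ← intervalIntegral.integral_neg]
  simp only [zero_add, add_zero, deriv_circleMap, h, h0, neg_mul, neg_smul, neg_neg]

end CircleIntegral

/-! ### Riesz idempotents as Cauchy integrals. -/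

section RieszProjection

variable {H : Type*} [NormedAddCommGroup H] [InnerProductSpace ℂ H]

theorem sub_mul_resolvent {T : H →L[ℂ] H} {z : ℂ} (hz : z ∈ resolventSet ℂ T) :
    (algebraMap ℂ _ z - T) * resolvent T z = 1 :=
  Ring.mul_inverse_cancel _ hz

theorem resolvent_mul_sub {T : H →L[ℂ] H} {z : ℂ} (hz : z ∈ resolventSet ℂ T) :
    resolvent T z * (algebraMap ℂ _ z - T) = 1 :=
  Ring.inverse_mul_cancel _ hz

theorem IsolatingRadius.annulus_subset {T : H →L[ℂ] H} {α : ℂ} {ρ r s : ℝ}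
    (h : IsolatingRadius T α ρ) (hs : 0 < s) (hr : r ≤ ρ) :
    Metric.closedBall α r \ Metric.ball α s ⊆ resolventSet ℂ T := by
  intro z hz
  by_contra hzT
  have : z = α := h.2 ⟨Metric.closedBall_subset_closedBall hr hz.1, hzT⟩
  exact hz.2 (this ▸ Metric.mem_ball_self hs)

theorem IsolatingRadius.mono {T : H →L[ℂ] H} {α : ℂ} {ρ s : ℝ}
    (h : IsolatingRadius T α ρ) (hs : 0 < s) (hsρ : s ≤ ρ) : IsolatingRadius T α s :=
  ⟨hs, (Set.inter_subset_inter_left _ (Metric.closedBall_subset_closedBall hsρ)).trans h.2⟩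

theorem smul_resolvent_mul_resolvent {T : H →L[ℂ] H} {z w : ℂ} (hz : z ∈ resolventSet ℂ T)
    (hw : w ∈ resolventSet ℂ T) :
    (w - z) • (resolvent T z * resolvent T w) = resolvent T z - resolvent T w := by
  calc (w - z) • (resolvent T z * resolvent T w)
      = resolvent T z * ((algebraMap ℂ _ w - T) - (algebraMap ℂ _ z - T)) * resolvent T w := by
        rw [sub_sub_sub_cancel_right, ← map_sub, Algebra.algebraMap_eq_smul_one, mul_smul_comm,
          mul_one, smul_mul_assoc]
    _ = resolvent T z - resolvent T w := by
        rw [mul_sub, sub_mul, mul_assoc, sub_mul_resolvent hw, resolvent_mul_sub hz, one_mul,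
          mul_one]

theorem sphere_subset_annulus {α : ℂ} {r s : ℝ} (hsr : s ≤ r) :
    Metric.sphere α s ⊆ Metric.closedBall α r \ Metric.ball α s := fun _ hz =>
  ⟨Metric.closedBall_subset_closedBall hsr (Metric.sphere_subset_closedBall hz),
    fun h => (Metric.mem_ball.1 h).ne hz⟩

theorem sphere_subset_annulus' {α : ℂ} {r s : ℝ} (hsr : s ≤ r) :
    Metric.sphere α r ⊆ Metric.closedBall α r \ Metric.ball α s := fun _ hz =>
  ⟨Metric.sphere_subset_closedBall hz,
    fun h => ((Metric.mem_ball.1 h).trans_le hsr).ne hz⟩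

variable [CompleteSpace H]

/-- Only the annulus must be free of spectrum: for a perturbed operator the point `α` may split into
several, or cease to be spectral. -/
theorem cauchyResolvent_eq_of_annulus {T : H →L[ℂ] H} {α : ℂ} {r s : ℝ} (hs : 0 < s) (hsr : s ≤ r)
    (h : Metric.closedBall α r \ Metric.ball α s ⊆ resolventSet ℂ T) :
    cauchyResolvent T α r = cauchyResolvent T α s := by
  have hd : ∀ z ∈ Metric.closedBall α r \ Metric.ball α s,
      DifferentiableAt ℂ (resolvent T) z := fun z hz =>
    (spectrum.hasDerivAt_resolvent_const_left (h hz)).differentiableAt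
  unfold cauchyResolvent
  congr 1
  refine Complex.circleIntegral_eq_of_differentiable_on_annulus_off_countable hs hsr
    Set.countable_empty (fun z hz => (hd z hz).continuousAt.continuousWithinAt) fun z hz => ?_
  exact hd z ⟨Metric.ball_subset_closedBall hz.1.1,
    fun h => hz.1.2 (Metric.ball_subset_closedBall h)⟩

/-- The resolvent identity splits the product on two concentric circles. Integrating `(w - z)⁻¹`
over the outer circle gives `2πi`, over the inner one `0`, so one term survives. -/
theorem circleIntegral_resolvent_mul {T : H →L[ℂ] H} {α : ℂ} {r s : ℝ} (hs : 0 < s) (hsr : s < r)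
    (h : Metric.closedBall α r \ Metric.ball α s ⊆ resolventSet ℂ T) :
    (∮ z in C(α, s), resolvent T z) * (∮ w in C(α, r), resolvent T w) =
      (2 * π * Complex.I : ℂ) • ∮ z in C(α, s), resolvent T z := by
  have hr : 0 < r := hs.trans hsr
  have hSs := (sphere_subset_annulus (α := α) hsr.le).trans h
  have hSr := (sphere_subset_annulus' (α := α) hsr.le).trans h
  have hcs := continuousOn_resolvent hSs
  have hcr := continuousOn_resolvent hSr
  have hne : ∀ z ∈ Metric.sphere α s, ∀ w ∈ Metric.sphere α r, w - z ≠ 0 := by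
    intro z hz w hw hwz
    rw [sub_eq_zero] at hwz
    rw [hwz] at hw
    exact hsr.ne ((Metric.mem_sphere.1 hz).symm.trans hw)
  have hinv : ContinuousOn (fun p : ℂ × ℂ => (p.2 - p.1)⁻¹)
      (Metric.sphere α s ×ˢ Metric.sphere α r) :=
    ContinuousOn.inv₀ (by fun_prop) fun p hp => hne p.1 hp.1 p.2 hp.2
  have hinv1 : ∀ z ∈ Metric.sphere α s,
      ContinuousOn (fun w : ℂ => (w - z)⁻¹) (Metric.sphere α r) := fun z hz =>
    ContinuousOn.inv₀ (by fun_prop) fun w hw => hne z hz w hw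
  have e1 : (∮ z in C(α, s), resolvent T z) * (∮ w in C(α, r), resolvent T w) =
      ∮ z in C(α, s), ∮ w in C(α, r), resolvent T z * resolvent T w := by
    have := clm_apply_circleIntegral
      ((ContinuousLinearMap.mul ℂ (H →L[ℂ] H)).flip (∮ w in C(α, r), resolvent T w))
      (hcs.circleIntegrable hs.le)
    simp only [ContinuousLinearMap.flip_apply, ContinuousLinearMap.mul_apply'] at this
    rw [this]
    refine circleIntegral.integral_congr hs.le fun z _ => ?_
    have := clm_apply_circleIntegral (ContinuousLinearMap.mul ℂ (H →L[ℂ] H) (resolvent T z))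
      (hcr.circleIntegrable hr.le)
    simpa only [ContinuousLinearMap.mul_apply'] using this
  have e2 : ∀ z ∈ Metric.sphere α s, (∮ w in C(α, r), resolvent T z * resolvent T w) =
      (2 * π * Complex.I : ℂ) • resolvent T z - ∮ w in C(α, r), (w - z)⁻¹ • resolvent T w := by
    intro z hz
    have hzb : z ∈ Metric.ball α r := (Metric.mem_sphere.1 hz).trans_lt hsr
    rw [← circleIntegral.integral_sub_inv_of_mem_ball hzb, ← circleIntegral.integral_smul_const,
      ← circleIntegral.integral_sub]
    · refine circleIntegral.integral_congr hr.le fun w hw => ?_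
      rw [← smul_sub, ← smul_resolvent_mul_resolvent (hSs hz) (hSr hw), smul_smul,
        inv_mul_cancel₀ (hne z hz w hw), one_smul]
    · exact ((hinv1 z hz).smul continuousOn_const).circleIntegrable hr.le
    · exact ((hinv1 z hz).smul hcr).circleIntegrable hr.le
  have hF : ContinuousOn (Function.uncurry fun z w : ℂ => (w - z)⁻¹ • resolvent T w)
      (Metric.sphere α s ×ˢ Metric.sphere α r) :=
    hinv.smul (hcr.comp continuousOn_snd fun p hp => hp.2)
  have e3 : (∮ z in C(α, s), ∮ w in C(α, r), (w - z)⁻¹ • resolvent T w) = 0 := by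
    rw [circleIntegral_swap hs.le hr.le hF]
    rw [circleIntegral.integral_congr (g := fun _ => 0) hr.le]
    · simp [circleIntegral]
    intro w hw
    have hne' : ∀ z ∈ Metric.closedBall α s, w - z ≠ 0 := by
      intro z hz hwz
      rw [sub_eq_zero] at hwz
      rw [← hwz] at hz
      exact hsr.not_ge ((Metric.mem_sphere.1 hw).symm.le.trans hz)
    dsimp only
    rw [circleIntegral.integral_smul_const,
      Complex.circleIntegral_eq_zero_of_differentiable_on_off_countable hs.le Set.countable_empty,
      zero_smul]
    · exact ContinuousOn.inv₀ (by fun_prop) hne'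
    · intro z hz
      exact DifferentiableAt.inv (by fun_prop) (hne' z (Metric.ball_subset_closedBall hz.1))
  have e4 : ∀ z ∈ Metric.sphere α s, (∮ w in C(α, r), (w - z)⁻¹ • resolvent T w) =
      (2 * π * Complex.I : ℂ) • resolvent T z -
        resolvent T z * (∮ w in C(α, r), resolvent T w) := by
    intro z hz
    have := clm_apply_circleIntegral (ContinuousLinearMap.mul ℂ (H →L[ℂ] H) (resolvent T z))
      (hcr.circleIntegrable hr.le)
    simp only [ContinuousLinearMap.mul_apply'] at this
    rw [this, e2 z hz, sub_sub_cancel]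
  have hsmul : ContinuousOn (fun z => (2 * π * Complex.I : ℂ) • resolvent T z)
      (Metric.sphere α s) := hcs.const_smul (2 * π * Complex.I : ℂ)
  have hmul : ContinuousOn (fun z => resolvent T z * ∮ w in C(α, r), resolvent T w)
      (Metric.sphere α s) :=
    ((ContinuousLinearMap.mul ℂ (H →L[ℂ] H)).flip
      (∮ w in C(α, r), resolvent T w)).continuous.comp_continuousOn hcs
  rw [e1, circleIntegral.integral_congr hs.le e2, circleIntegral.integral_sub,
    circleIntegral.integral_smul, e3, sub_zero]
  · exact hsmul.circleIntegrable hs.le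
  · exact ((hsmul.sub hmul).congr e4).circleIntegrable hs.le

theorem cauchyResolvent_mul_self {T : H →L[ℂ] H} {α : ℂ} {r s : ℝ} (hs : 0 < s) (hsr : s < r)
    (h : Metric.closedBall α r \ Metric.ball α s ⊆ resolventSet ℂ T) :
    cauchyResolvent T α s * cauchyResolvent T α s = cauchyResolvent T α s := by
  nth_rw 2 [← cauchyResolvent_eq_of_annulus hs hsr.le h]
  rw [cauchyResolvent, cauchyResolvent, smul_mul_smul_comm, circleIntegral_resolvent_mul hs hsr h,
    smul_smul, mul_assoc, inv_mul_cancel₀ Complex.two_pi_I_ne_zero, mul_one]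

/-- This `G` inverts `T ^ 2` on the Riesz range. Since `T ^ 2 = z ^ 2 - (z - T) * (z + T)`,
multiplying `z⁻² • resolvent T z` by `T ^ 2` gives the resolvent minus `z⁻² • (z + T)`, which is
holomorphic on a disc avoiding `0` and integrates to zero. -/
theorem exists_mul_sq_eq_cauchyResolvent {T : H →L[ℂ] H} {α : ℂ} {s : ℝ} (hs : 0 < s)
    (h : Metric.sphere α s ⊆ resolventSet ℂ T) (h0 : (0 : ℂ) ∉ Metric.closedBall α s) :
    ∃ G : H →L[ℂ] H, G * T ^ 2 = cauchyResolvent T α s := by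
  have hne : ∀ z ∈ Metric.closedBall α s, z ^ 2 ≠ 0 := fun z hz hz0 =>
    h0 (pow_eq_zero_iff two_ne_zero |>.1 hz0 ▸ hz)
  have hneS : ∀ z ∈ Metric.sphere α s, z ^ 2 ≠ 0 := fun z hz =>
    hne z (Metric.sphere_subset_closedBall hz)
  have hc := continuousOn_resolvent h
  have hcinv : ContinuousOn (fun z : ℂ => (z ^ 2)⁻¹) (Metric.closedBall α s) :=
    ContinuousOn.inv₀ (by fun_prop) hne
  have hcS := hcinv.mono Metric.sphere_subset_closedBall
  have hcE : ContinuousOn (fun z : ℂ => (z ^ 2)⁻¹ • (z • (1 : H →L[ℂ] H) + T))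
      (Metric.closedBall α s) := hcinv.smul (by fun_prop)
  refine ⟨(2 * π * Complex.I : ℂ)⁻¹ • ∮ z in C(α, s), (z ^ 2)⁻¹ • resolvent T z, ?_⟩
  rw [cauchyResolvent, smul_mul_assoc]
  congr 1
  have := clm_apply_circleIntegral ((ContinuousLinearMap.mul ℂ (H →L[ℂ] H)).flip (T ^ 2))
    (f := fun z => (z ^ 2)⁻¹ • resolvent T z) ((hcS.smul hc).circleIntegrable hs.le)
  simp only [ContinuousLinearMap.flip_apply, ContinuousLinearMap.mul_apply'] at this
  rw [this]
  have hz : (∮ z in C(α, s), (z ^ 2)⁻¹ • (z • (1 : H →L[ℂ] H) + T)) = 0 := by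
    refine Complex.circleIntegral_eq_zero_of_differentiable_on_off_countable hs.le
      Set.countable_empty hcE fun z hz => ?_
    have hzi : DifferentiableAt ℂ (fun z : ℂ => (z ^ 2)⁻¹) z :=
      DifferentiableAt.inv (by fun_prop) (hne z (Metric.ball_subset_closedBall hz.1))
    exact hzi.smul (by fun_prop : DifferentiableAt ℂ (fun z : ℂ => z • (1 : H →L[ℂ] H) + T) z)
  rw [← sub_zero (∮ z in C(α, s), resolvent T z), ← hz, ← circleIntegral.integral_sub]
  · refine circleIntegral.integral_congr hs.le fun z hz => ?_
    have hsq : T ^ 2 = z ^ 2 • (1 : H →L[ℂ] H)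
        - (algebraMap ℂ _ z - T) * (z • (1 : H →L[ℂ] H) + T) := by
      rw [Algebra.algebraMap_eq_smul_one, sub_mul, mul_add, mul_add, pow_two, pow_two]
      simp [smul_smul]
      abel
    rw [smul_mul_assoc, hsq, mul_sub, ← mul_assoc, resolvent_mul_sub (h hz), one_mul, smul_sub,
      mul_smul_comm, mul_one, smul_smul, inv_mul_cancel₀ (hneS z hz), one_smul]
  · exact hc.circleIntegrable hs.le
  · exact (hcE.mono Metric.sphere_subset_closedBall).circleIntegrable hs.le

/-- Anticommutation gives `X * resolvent T z = -(resolvent T (-z) * X)`; the substitution `z ↦ -z`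
cancels the sign. -/
theorem mul_cauchyResolvent_of_anticommuting {T X : H →L[ℂ] H} (hX : X * T = -(T * X)) {α : ℂ}
    {s : ℝ} (hs : 0 < s) (h : Metric.sphere α s ⊆ resolventSet ℂ T)
    (h' : Metric.sphere (-α) s ⊆ resolventSet ℂ T) :
    X * cauchyResolvent T α s = cauchyResolvent T (-α) s * X := by
  have hneg : ∀ z ∈ Metric.sphere α s, -z ∈ Metric.sphere (-α) s := fun z hz => by
    rw [mem_sphere_iff_norm] at hz ⊢
    rwa [← norm_neg, neg_sub_neg, neg_sub]
  rw [cauchyResolvent, cauchyResolvent, mul_smul_comm, smul_mul_assoc]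
  congr 1
  have e1 := clm_apply_circleIntegral (ContinuousLinearMap.mul ℂ (H →L[ℂ] H) X)
    ((continuousOn_resolvent h).circleIntegrable hs.le)
  have e2 := clm_apply_circleIntegral ((ContinuousLinearMap.mul ℂ (H →L[ℂ] H)).flip X)
    ((continuousOn_resolvent h').circleIntegrable hs.le)
  simp only [ContinuousLinearMap.flip_apply, ContinuousLinearMap.mul_apply'] at e1 e2
  rw [e1, e2, ← neg_neg (∮ z in C(-α, s), resolvent T z * X),
    ← circleIntegral_comp_neg fun z => resolvent T z * X, circleIntegral, circleIntegral,
    ← intervalIntegral.integral_neg]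
  congr 1
  funext θ
  have hz := circleMap_mem_sphere α hs.le θ
  set z := circleMap α s θ
  have hz1 := h hz
  have hz2 := h' (hneg z hz)
  have key : (algebraMap ℂ _ (-z) - T) * X = -(X * (algebraMap ℂ _ z - T)) := by
    rw [mul_sub, hX, sub_mul, map_neg, neg_mul, Algebra.commutes]; abel
  rw [← smul_neg]
  congr 1
  calc X * resolvent T z
      = resolvent T (-z) * ((algebraMap ℂ _ (-z) - T) * X) * resolvent T z := by
        rw [← mul_assoc (resolvent T (-z)), resolvent_mul_sub hz2, one_mul]
    _ = -(resolvent T (-z) * X) := by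
        rw [key, mul_neg, neg_mul, mul_assoc, mul_assoc, sub_mul_resolvent hz1, mul_one]

theorem eventually_norm_cauchyResolvent_sub_lt_one {T : H →L[ℂ] H} {α : ℂ} {s : ℝ} (hs : 0 < s)
    (h : Metric.sphere α s ⊆ resolventSet ℂ T) :
    ∀ᶠ S in 𝓝 T, ‖cauchyResolvent S α s - cauchyResolvent T α s‖ < 1 := by
  -- The Cauchy integral is at most `s` times the supremum of the integrand, so this tolerance
  -- yields `1 / 2`.
  have hε : 0 < (2 * s)⁻¹ := by positivity
  filter_upwards [eventually_subset_resolventSet (isCompact_sphere α s) h,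
    eventually_norm_resolvent_sub_lt (isCompact_sphere α s) h hε] with S hS1 hS2
  rw [cauchyResolvent, cauchyResolvent, ← smul_sub, ← circleIntegral.integral_sub
    ((continuousOn_resolvent hS1).circleIntegrable hs.le)
    ((continuousOn_resolvent h).circleIntegrable hs.le)]
  refine (circleIntegral.norm_two_pi_i_inv_smul_integral_le_of_norm_le_const hs.le
    fun z hz => (hS2 z hz).le).trans_lt ?_
  rw [mul_inv, mul_left_comm, mul_inv_cancel₀ hs.ne']
  norm_num

end RieszProjection

/-! ### Comparison of ranks and passage to the limit. -/

section Rank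

variable {H : Type*} [NormedAddCommGroup H] [InnerProductSpace ℂ H]

theorem rank_range_le_of_injOn {P Q Y : H →L[ℂ] H} (hP : P * P = P)
    (hmap : ∀ v, P v = v → ∃ w, Q w = Y v) (hinj : ∀ v, P v = v → Y v = 0 → v = 0) :
    Module.rank ℂ (LinearMap.range (P : H →ₗ[ℂ] H)) ≤
      Module.rank ℂ (LinearMap.range (Q : H →ₗ[ℂ] H)) := by
  have hfix : ∀ v ∈ LinearMap.range (P : H →ₗ[ℂ] H), P v = v := by
    rintro _ ⟨w, rfl⟩
    exact DFunLike.congr_fun hP w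
  refine LinearMap.rank_le_of_injective
    ((Y : H →ₗ[ℂ] H).restrict (p := LinearMap.range (P : H →ₗ[ℂ] H))
      (q := LinearMap.range (Q : H →ₗ[ℂ] H)) fun v hv => hmap v (hfix v hv)) ?_
  rw [injective_iff_map_eq_zero]
  intro v hv
  exact Subtype.ext (hinj v (hfix v v.2) (congrArg Subtype.val hv))

/-- `Q` is injective on the range of `P`: a fixed vector `v` of `P` killed by `Q` satisfies `‖v‖ ≤
‖P - Q‖ * ‖v‖`. -/
theorem rank_range_le_of_norm_sub_lt_one {P Q : H →L[ℂ] H} (hP : P * P = P)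
    (h : ‖P - Q‖ < 1) :
    Module.rank ℂ (LinearMap.range (P : H →ₗ[ℂ] H)) ≤
      Module.rank ℂ (LinearMap.range (Q : H →ₗ[ℂ] H)) := by
  refine rank_range_le_of_injOn (Y := Q) hP (fun v _ => ⟨v, rfl⟩) fun v hv hQ => ?_
  by_contra hv0
  have h1 : ‖v‖ ≤ ‖P - Q‖ * ‖v‖ := by
    simpa [hv, hQ] using (P - Q).le_opNorm v
  have h2 : 0 < ‖v‖ := norm_pos_iff.2 hv0
  nlinarith

variable [CompleteSpace H]

theorem eventually_rank_range_cauchyResolvent_eq {T : H →L[ℂ] H} {α : ℂ} {r s : ℝ} (hs : 0 < s)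
    (hsr : s < r) (h : Metric.closedBall α r \ Metric.ball α s ⊆ resolventSet ℂ T) :
    ∀ᶠ S in 𝓝 T, Metric.closedBall α r \ Metric.ball α s ⊆ resolventSet ℂ S ∧
      Module.rank ℂ (LinearMap.range (cauchyResolvent S α s : H →ₗ[ℂ] H)) =
        Module.rank ℂ (LinearMap.range (cauchyResolvent T α s : H →ₗ[ℂ] H)) := by
  filter_upwards [eventually_subset_resolventSet
      ((isCompact_closedBall α r).diff Metric.isOpen_ball) h,
    eventually_norm_cauchyResolvent_sub_lt_one hs ((sphere_subset_annulus hsr.le).trans h)]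
    with S hS1 hS2
  exact ⟨hS1, le_antisymm
    (rank_range_le_of_norm_sub_lt_one (cauchyResolvent_mul_self hs hsr hS1) hS2)
    (rank_range_le_of_norm_sub_lt_one (cauchyResolvent_mul_self hs hsr h)
      (by rwa [norm_sub_rev]))⟩

theorem rank_range_cauchyResolvent_le_of_anticommuting {T X : H →L[ℂ] H}
    (hX : X * T = -(T * X)) (hXT : X ^ 4 = T ^ 2) {α : ℂ} {r s : ℝ} (hs : 0 < s) (hsr : s < r)
    (h : Metric.closedBall α r \ Metric.ball α s ⊆ resolventSet ℂ T)
    (h' : Metric.closedBall (-α) r \ Metric.ball (-α) s ⊆ resolventSet ℂ T)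
    (h0 : (0 : ℂ) ∉ Metric.closedBall α s) :
    Module.rank ℂ (LinearMap.range (cauchyResolvent T α s : H →ₗ[ℂ] H)) ≤
      Module.rank ℂ (LinearMap.range (cauchyResolvent T (-α) s : H →ₗ[ℂ] H)) := by
  have hS := (sphere_subset_annulus hsr.le).trans h
  have hXE := mul_cauchyResolvent_of_anticommuting hX hs hS
    ((sphere_subset_annulus hsr.le).trans h')
  obtain ⟨G, hG⟩ := exists_mul_sq_eq_cauchyResolvent hs hS h0
  refine rank_range_le_of_injOn (Y := X) (cauchyResolvent_mul_self hs hsr h) (fun v hv => ?_)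
    fun v hv hXv => ?_
  · refine ⟨X v, ?_⟩
    have := DFunLike.congr_fun hXE v
    simp only [mul_apply_eq_comp] at this
    rw [← this, hv]
  -- Injectivity: `v = G (X ^ 4 v)`, so `X v = 0` forces `v = 0`.
  · rw [← hv, ← hG, ← hXT, pow_succ]
    simp [hXv]

theorem rank_range_cauchyResolvent_neg_eq {T : H →L[ℂ] H}
    (hT : T ∈ commutators (nilTwo (H →L[ℂ] H))) {α : ℂ} {r s : ℝ} (hs : 0 < s) (hsr : s < r)
    (h : Metric.closedBall α r \ Metric.ball α s ⊆ resolventSet ℂ T)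
    (h' : Metric.closedBall (-α) r \ Metric.ball (-α) s ⊆ resolventSet ℂ T) (h0 : s < ‖α‖) :
    Module.rank ℂ (LinearMap.range (cauchyResolvent T α s : H →ₗ[ℂ] H)) =
      Module.rank ℂ (LinearMap.range (cauchyResolvent T (-α) s : H →ₗ[ℂ] H)) := by
  obtain ⟨X, hX, hXT⟩ := exists_anticommuting_of_mem_commutators hT
  refine le_antisymm
    (rank_range_cauchyResolvent_le_of_anticommuting hX hXT hs hsr h h' (by simpa using h0)) ?_
  have := rank_range_cauchyResolvent_le_of_anticommuting (α := -α) hX hXT hs hsr h'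
    (by rwa [neg_neg]) (by simpa using h0)
  rwa [neg_neg] at this

theorem dimension_rieszSpace_neg_eq {T : H →L[ℂ] H}
    (hT : T ∈ closure (commutators (nilTwo (H →L[ℂ] H)))) {α : ℂ}
    (hα : IsIsolatedPoint (spectrum ℂ T) α) (hα' : IsIsolatedPoint (spectrum ℂ T) (-α)) :
    dimension (rieszSpace T α) = dimension (rieszSpace T (-α)) := by
  rcases eq_or_ne α 0 with rfl | h0
  · rw [neg_zero]
  obtain ⟨ρ, hρ⟩ := exists_isolatingRadius hα
  obtain ⟨ρ', hρ'⟩ := exists_isolatingRadius hα'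
  -- One radius serves both points; keeping it below `‖α‖` leaves `0` outside both discs.
  obtain ⟨r, hr, hrm⟩ := exists_between (lt_min (lt_min hρ.1 hρ'.1) (norm_pos_iff.2 h0))
  obtain ⟨hrρ, hrα⟩ := lt_min_iff.1 hrm
  obtain ⟨hrρ, hrρ'⟩ := lt_min_iff.1 hrρ
  obtain ⟨s, hs, hsr⟩ := exists_between hr
  have hann := hρ.annulus_subset hs hrρ.le
  have hann' := hρ'.annulus_subset hs hrρ'.le
  obtain ⟨S, hS, ⟨hS1, hS2⟩, hS3, hS4⟩ := ((mem_closure_iff_frequently.1 hT).and_eventually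
    ((eventually_rank_range_cauchyResolvent_eq hs hsr hann).and
      (eventually_rank_range_cauchyResolvent_eq hs hsr hann'))).exists
  rw [dimension, dimension, rieszSpace, rieszSpace,
    rieszIdempotent_eq (hρ.mono hs (hsr.trans hrρ).le),
    rieszIdempotent_eq (hρ'.mono hs (hsr.trans hrρ').le), ← hS2, ← hS4,
    rank_range_cauchyResolvent_neg_eq hS hs hsr hS1 hS3 (hsr.trans hrα)]

end Rank

end SquareZeroCommutator

end

theorem proposition2p12
    {H : Type*} [NormedAddCommGroup H] [InnerProductSpace ℂ H] [CompleteSpace H]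
    [TopologicalSpace.SeparableSpace H] (T : H →L[ℂ] H) :
    (T ∈ SquareZeroCommutator.commutators (SquareZeroCommutator.nilTwo (H →L[ℂ] H)) →
      SquareZeroCommutator.EveryComponentMeets (spectrum ℂ T) (spectrum ℂ (-T)) ∧
      SquareZeroCommutator.EveryComponentMeets (SquareZeroCommutator.essentialSpectrum T)
        (SquareZeroCommutator.essentialSpectrum (-T))) ∧
    (T ∈ closure (SquareZeroCommutator.commutators
        (SquareZeroCommutator.nilTwo (H →L[ℂ] H))) →
      SquareZeroCommutator.EveryComponentMeets (spectrum ℂ T) (spectrum ℂ (-T)) ∧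
      SquareZeroCommutator.EveryComponentMeets (SquareZeroCommutator.essentialSpectrum T)
        (SquareZeroCommutator.essentialSpectrum (-T)) ∧
      ∀ α : ℂ, SquareZeroCommutator.IsIsolatedPoint (spectrum ℂ T) α →
        SquareZeroCommutator.IsIsolatedPoint (spectrum ℂ T) (-α) →
        SquareZeroCommutator.dimension (SquareZeroCommutator.rieszSpace T α) =
          SquareZeroCommutator.dimension (SquareZeroCommutator.rieszSpace T (-α))) :=
  ⟨fun hT => ⟨SquareZeroCommutator.everyComponentMeets_of_mem_closure (subset_closure hT),
      SquareZeroCommutator.everyComponentMeets_essentialSpectrum_of_mem_closure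
        (subset_closure hT)⟩,
    fun hT => ⟨SquareZeroCommutator.everyComponentMeets_of_mem_closure hT,
      SquareZeroCommutator.everyComponentMeets_essentialSpectrum_of_mem_closure hT,
      fun _ hα hα' => SquareZeroCommutator.dimension_rieszSpace_neg_eq hT hα hα'⟩⟩
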